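/- Let $h$ be a known probability density on $\mathbb{R}$ (with respect to Lebesgue measure $\lambda$) of a noise variable $\varepsilon$ with $E\varepsilon=0$ and $0<E\varepsilon^2<\infty$. Let $\Theta\subseteq\mathbb{R}^k$ be an open set with $0\in\Theta$, and let $\{f_\theta\}_{\theta\in\Theta}$ be a family of probability densities on $\mathbb{R}$. Put $$q(y;\theta)=\int_{\mathbb{R}} f_\theta(s)\,h(y-s)\,ds ,$$ let $Q_\theta$ be the distribution with density $q(\cdot\,;\theta)$, and define the score function and the Fisher information matrix by $$\dot l(y;\theta)=\frac{\nabla_\theta\, q(y;\theta)}{q(y;\theta)}\,1_{[q(y;\theta)>0]},\qquad I(\theta)=\int_{\mathbb{R}}\dot l(y;\theta)\,\dot l(y;\theta)^T\,dQ_\theta(y).$$ Assume that the deconvolution problem is regular, that is: (B1) for $\lambda$-almost all $y$ the function $\theta\mapsto q(y;\theta)$ is continuously differentiable on $\Theta$; (B2) $|\dot l(\cdot\,;\theta)|\in L_2(Q_\theta)$ for all $\theta\in\Theta$; (B3) $I(\theta)$ is nonsingular for all $\theta\in\Theta$ and continuous in $\theta$. Then the following hold. (1) The efficient score vector for testing $H_0:\theta=0$,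 that is, $l^\ast(y)=\dot l(y;0)$ (the model has no nuisance parameter), is given by $$l^\ast(y)=\frac{\frac{\partial}{\partial\theta}\Bigl(\int_{\mathbb{R}} f_\theta(s)\,h(y-s)\,ds\Bigr)\Bigr|_{\theta=0}}{\int_{\mathbb{R}} f_0(s)\,h(y-s)\,ds},$$ where the right-hand side is read as $0$ when the denominator vanishes and the derivative exists for $\lambda$-almost all $y$. This function is the score at $\theta=0$ in the Hilbert space sense: $l^\ast\in L_2(Q_0)$, and $$\Bigl\|\sqrt{q(\cdot\,;\theta)}-\sqrt{q(\cdot\,;0)}-\tfrac12\langle\theta, l^\ast\rangle\sqrt{q(\cdot\,;0)}\Bigr\|_{L_2(\lambda)}=o(|\theta|)\quad\text{as }\theta\to0 .$$ (2) Let $Y_j=X_j+\varepsilon_j$, $j=1,2,\dots$, where all the $X_j,\varepsilon_j$ are independent, the $\varepsilon_j$ have density $h$, and (hypothesis $H_0$) the $X_j$ have density $f_0$. Treating $l^\ast$ as a row vector, put $$L=\bigl\{E_0\,[l^\ast(Y)]^T l^\ast(Y)\bigr\}^{-1},\qquad U_k=\Bigl\{\frac1{\sqrt n}\sum_{j=1}^n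 l^\ast(Y_j)\Bigr\}\,L\,\Bigl\{\frac1{\sqrt n}\sum_{j=1}^n l^\ast(Y_j)\Bigr\}^T,$$ where $E_0$ is the expectation for $Y\sim Q_0$. Then $U_k$ converges in distribution to $\chi^2_k$ as $n\to\infty$. -/

import Mathlib

open MeasureTheory ProbabilityTheory Filter Topology

noncomputable section

namespace Deconvolution

/-- `f` is a probability density on `ℝ` with respect to Lebesgue measure. -/
structure IsDensity (f : ℝ → ℝ) : Prop where
  measurable : Measurable f
  nonneg : ∀ x, 0 ≤ f x
  lintegral_eq_one : ∫⁻ x, ENNReal.ofReal (f x) = 1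

/-- `h` is the density of a centred noise variable `ε` with `0 < E ε² < ∞`. -/
structure IsNoiseDensity (h : ℝ → ℝ) : Prop where
  isDensity : IsDensity h
  integrable_sq : Integrable (fun x : ℝ => x ^ 2 * h x)
  mean_eq_zero : ∫ x : ℝ, x * h x = 0
  second_moment_pos : 0 < ∫ x : ℝ, x ^ 2 * h x

/-- The measure on `ℝ` with Lebesgue density `f`. -/
def densityMeasure (f : ℝ → ℝ) : Measure ℝ :=
  volume.withDensity (fun x => ENNReal.ofReal (f x))

variable {k : ℕ}

/-- The density `q(y; θ) = ∫ f_θ(s) h(y - s) ds` of `Y = X + ε`, when `X` has density `f_θ`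
and `ε` is independent of `X` with density `h`. -/
def q (f : EuclideanSpace ℝ (Fin k) → ℝ → ℝ) (h : ℝ → ℝ)
    (y : ℝ) (θ : EuclideanSpace ℝ (Fin k)) : ℝ :=
  ∫ s, f θ s * h (y - s)

/-- The law `Q_θ` with density `q(·; θ)`. -/
def Q (f : EuclideanSpace ℝ (Fin k) → ℝ → ℝ) (h : ℝ → ℝ)
    (θ : EuclideanSpace ℝ (Fin k)) : Measure ℝ :=
  densityMeasure (fun y => q f h y θ)

open Classical in
/-- The score function `l̇(y; θ) = (∇_θ q(y; θ) / q(y; θ)) 1_{q(y; θ) > 0}`. -/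
def score (f : EuclideanSpace ℝ (Fin k) → ℝ → ℝ) (h : ℝ → ℝ)
    (y : ℝ) (θ : EuclideanSpace ℝ (Fin k)) : EuclideanSpace ℝ (Fin k) :=
  if 0 < q f h y θ then (q f h y θ)⁻¹ • gradient (fun θ' => q f h y θ') θ else 0

/-- The Fisher information matrix `I(θ) = ∫ l̇(y; θ) l̇(y; θ)ᵀ dQ_θ(y)`. -/
def fisherInformation (f : EuclideanSpace ℝ (Fin k) → ℝ → ℝ) (h : ℝ → ℝ)
    (θ : EuclideanSpace ℝ (Fin k)) : Matrix (Fin k) (Fin k) ℝ :=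
  Matrix.of fun i j => ∫ y, score f h y θ i * score f h y θ j ∂(Q f h θ)

/-- A regular deconvolution problem with parameter set `Θ`, an open subset of `ℝ^k`. -/
structure IsRegular (Θ : Set (EuclideanSpace ℝ (Fin k)))
    (f : EuclideanSpace ℝ (Fin k) → ℝ → ℝ) (h : ℝ → ℝ) : Prop where
  isOpen : IsOpen Θ
  density : ∀ θ ∈ Θ, IsDensity (f θ)
  noise : IsNoiseDensity h
  /-- `q(y; ·)` is continuously differentiable on `Θ` for Lebesgue-almost all `y`. -/
  contDiff : ∀ᵐ y : ℝ, ContDiffOn ℝ 1 (fun θ => q f h y θ) Θ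
  /-- `|l̇(θ)| ∈ L₂(Q_θ)` for all `θ ∈ Θ`. -/
  memLp_score : ∀ θ ∈ Θ, MemLp (fun y => score f h y θ) 2 (Q f h θ)
  /-- `I(θ)` is nonsingular for all `θ ∈ Θ`. -/
  nonsingular : ∀ θ ∈ Θ, IsUnit (fisherInformation f h θ)
  /-- `I(θ)` is continuous in `θ`. -/
  continuous_information : ContinuousOn (fisherInformation f h) Θ

/-- `l` is the score at the parameter value `θ₀` in the Hilbert space sense: `l ∈ L₂(Q_{θ₀})`, and
`θ ↦ √q(·; θ) ∈ L₂(ℝ)` is Fréchet differentiable at `θ₀` with derivative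
`v ↦ ½ ⟨v, l⟩ √q(·; θ₀)`. -/
def IsQuadraticMeanScore (f : EuclideanSpace ℝ (Fin k) → ℝ → ℝ) (h : ℝ → ℝ)
    (θ₀ : EuclideanSpace ℝ (Fin k)) (l : ℝ → EuclideanSpace ℝ (Fin k)) : Prop :=
  MemLp l 2 (Q f h θ₀) ∧
  Tendsto (fun θ => eLpNorm (fun y => √(q f h y θ) - √(q f h y θ₀)
      - 1 / 2 * inner ℝ (θ - θ₀) (l y) * √(q f h y θ₀)) 2 volume / ‖θ - θ₀‖ₑ)
    (𝓝[≠] θ₀) (𝓝 0)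

/-- The efficient score vector `l*(y) = l̇(y; 0)` for testing `θ = 0`. There is no nuisance
parameter, so it is the score at `θ = 0`. -/
def efficientScore (f : EuclideanSpace ℝ (Fin k) → ℝ → ℝ) (h : ℝ → ℝ) (y : ℝ) :
    EuclideanSpace ℝ (Fin k) :=
  score f h y 0

/-- `L = {E₀ [l*(Y)]ᵀ l*(Y)}⁻¹` (with `l*` as a row vector), `E₀` the expectation for `Y ∼ Q_0`. -/
def L (f : EuclideanSpace ℝ (Fin k) → ℝ → ℝ) (h : ℝ → ℝ) : Matrix (Fin k) (Fin k) ℝ :=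
  (Matrix.of fun i j => ∫ y, efficientScore f h y i * efficientScore f h y j ∂(Q f h 0))⁻¹

/-- The normalized score sum `n^{-1/2} ∑_{j ≤ n} l*(Y_j)`; the observations are indexed from `0`. -/
def scoreSum (f : EuclideanSpace ℝ (Fin k) → ℝ → ℝ) (h : ℝ → ℝ) (n : ℕ) (Y : ℕ → ℝ) :
    EuclideanSpace ℝ (Fin k) :=
  (1 / √(n : ℝ)) • ∑ j ∈ Finset.range n, efficientScore f h (Y j)

/-- The score test statistic `U_k` computed from the first `n` observations. -/
def U (f : EuclideanSpace ℝ (Fin k) → ℝ → ℝ) (h : ℝ → ℝ) (n : ℕ) (Y : ℕ → ℝ) : ℝ :=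
  ∑ i, ∑ j, scoreSum f h n Y i * L f h i j * scoreSum f h n Y j

/-- The chi-square distribution with `k` degrees of freedom: the law of the sum of the squares of
`k` independent standard normal variables. -/
def chiSquare (k : ℕ) : Measure ℝ :=
  (Measure.pi (fun _ : Fin k => gaussianReal 0 1)).map (fun z => ∑ i, z i ^ 2)

instance (k : ℕ) : IsProbabilityMeasure (chiSquare k) :=
  Measure.isProbabilityMeasure_map
    (Finset.measurable_sum _ fun i _ => (measurable_pi_apply i).pow_const 2).aemeasurable

/-- The signals `X i` are i.i.d. with density `f₀`, the noises `ε i` are i.i.d. with density `h`,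
and all these variables are jointly independent. -/
structure IsSample {Ω : Type*} [MeasurableSpace Ω] (P : Measure Ω) (f₀ h : ℝ → ℝ)
    (X ε : ℕ → Ω → ℝ) : Prop where
  law_signal : ∀ i, HasLaw (X i) (densityMeasure f₀) P
  law_noise : ∀ i, HasLaw (ε i) (densityMeasure h) P
  indep_signal_noise : ∀ i, IndepFun (X i) (ε i) P
  indep : iIndepFun (fun i ω => (X i ω, ε i ω)) P

end Deconvolution

end

/-! Part (1) is Le Cam's theorem that a pointwise `C¹` family with continuous Fisher information is
differentiable in quadratic mean. Put `Z = (√q_θ - √q_0)/|θ|` and let `V` be its formal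
linearization `½⟨θ, l*⟩√q_0/|θ|`. Where `q_0 > 0`, `Z - V → 0` pointwise, and `V` is dominated by a
fixed `L²` function that vanishes where `q_0 = 0`. Integrating the derivative of the square root
along the segment from `0` to `θ` and applying Cauchy–Schwarz bounds `∫ Z²` by the largest
directional information on the segment (`lintegral_sqrt_sub_sq_le`), hence by `∫ V² + ε` near `0`.
Pointwise convergence together with this norm bound forces `Z - V → 0` in `L²`
(`tendsto_integral_sub_sq`); the bound also rules out mass escaping to `{q_0 = 0}`, where no
pointwise information is available.

For part (2), `√q_θ` is a differentiable curve on the unit sphere of `L²`, so it is orthogonal to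
its derivative, which says that the score has mean zero (`IsRegular.integral_inner_score`). The
information matrix is positive definite, so some `B` has `BᵀB = I(0)⁻¹`. The vectors `B l*(Y_j)` are
i.i.d., centred, with identity covariance, and `U` is the squared norm of their normalized sum. The
central limit theorem and continuous mapping give `χ²_k`. -/

namespace Deconvolution

/-! ### Densities and the law of the observations -/

section Density

theorem IsDensity.integrable {g : ℝ → ℝ} (hg : IsDensity g) : Integrable g := by
  refine ⟨hg.measurable.aestronglyMeasurable, ?_⟩
  rw [hasFiniteIntegral_iff_ofReal (ae_of_all _ hg.nonneg), hg.lintegral_eq_one]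
  exact ENNReal.one_lt_top

theorem IsDensity.integral_eq_one {g : ℝ → ℝ} (hg : IsDensity g) : ∫ x, g x = 1 := by
  rw [integral_eq_lintegral_of_nonneg_ae (ae_of_all _ hg.nonneg)
    hg.measurable.aestronglyMeasurable, hg.lintegral_eq_one, ENNReal.toReal_one]

theorem IsDensity.isProbabilityMeasure {g : ℝ → ℝ} (hg : IsDensity g) :
    IsProbabilityMeasure (densityMeasure g) :=
  ⟨by rw [densityMeasure, withDensity_apply _ MeasurableSet.univ, setLIntegral_univ,
    hg.lintegral_eq_one]⟩

theorem integral_densityMeasure {p : ℝ → ℝ} (hm : Measurable p) (h0 : ∀ y, 0 ≤ p y)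
    (g : ℝ → ℝ) : ∫ y, g y ∂(densityMeasure p) = ∫ y, p y * g y := by
  rw [densityMeasure, integral_withDensity_eq_integral_toReal_smul hm.ennreal_ofReal
    (ae_of_all _ fun _ => ENNReal.ofReal_lt_top)]
  simp [ENNReal.toReal_ofReal (h0 _)]

theorem integrable_densityMeasure_iff {p : ℝ → ℝ} (hm : Measurable p) (h0 : ∀ y, 0 ≤ p y)
    (g : ℝ → ℝ) : Integrable g (densityMeasure p) ↔ Integrable (fun y => g y * p y) := by
  rw [densityMeasure, integrable_withDensity_iff hm.ennreal_ofReal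
    (ae_of_all _ fun _ => ENNReal.ofReal_lt_top)]
  simp [ENNReal.toReal_ofReal (h0 _)]

variable {k : ℕ} {f : EuclideanSpace ℝ (Fin k) → ℝ → ℝ} {h : ℝ → ℝ}
  {θ : EuclideanSpace ℝ (Fin k)}

theorem q_nonneg (hf : IsDensity (f θ)) (hh : IsDensity h) (y : ℝ) : 0 ≤ q f h y θ :=
  integral_nonneg fun s => mul_nonneg (hf.nonneg s) (hh.nonneg _)

theorem measurable_q (hf : IsDensity (f θ)) (hh : IsDensity h) :
    Measurable (fun y => q f h y θ) := by
  refine (StronglyMeasurable.integral_prod_right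
    (f := fun (y s : ℝ) => f θ s * h (y - s)) ?_).measurable
  exact ((hf.measurable.comp measurable_snd).mul
    (hh.measurable.comp (measurable_fst.sub measurable_snd))).stronglyMeasurable

/-- The convolution integrand is integrable only for almost every `y`. At an exceptional `y` the
Bochner integral is `0` by convention while the `lintegral` is infinite, so equality is only almost
everywhere. -/
theorem ofReal_q_ae_eq (hf : IsDensity (f θ)) (hh : IsDensity h) :
    (fun y => ENNReal.ofReal (q f h y θ)) =ᵐ[volume]
      lconvolution (fun s => ENNReal.ofReal (f θ s)) (fun s => ENNReal.ofReal (h s)) volume := by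
  filter_upwards [hf.integrable.ae_convolution_exists (ContinuousLinearMap.mul ℝ ℝ) hh.integrable]
    with y hy
  have hy' : Integrable (fun s => f θ s * h (y - s)) := hy
  rw [q, ofReal_integral_eq_lintegral_ofReal hy'
    (ae_of_all _ fun s => mul_nonneg (hf.nonneg s) (hh.nonneg _)), lconvolution]
  refine lintegral_congr fun s => ?_
  rw [ENNReal.ofReal_mul (hf.nonneg s), neg_add_eq_sub]

theorem Q_eq_conv (hf : IsDensity (f θ)) (hh : IsDensity h) :
    Q f h θ = (densityMeasure (f θ)).conv (densityMeasure h) := by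
  rw [densityMeasure, densityMeasure, conv_withDensity_eq_lconvolution
    hf.measurable.ennreal_ofReal hh.measurable.ennreal_ofReal]
  exact withDensity_congr_ae (ofReal_q_ae_eq hf hh)

theorem isProbabilityMeasure_Q (hf : IsDensity (f θ)) (hh : IsDensity h) :
    IsProbabilityMeasure (Q f h θ) := by
  have := hf.isProbabilityMeasure
  have := hh.isProbabilityMeasure
  rw [Q_eq_conv hf hh]
  infer_instance

theorem isDensity_q (hf : IsDensity (f θ)) (hh : IsDensity h) :
    IsDensity (fun y => q f h y θ) where
  measurable := measurable_q hf hh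
  nonneg := q_nonneg hf hh
  lintegral_eq_one := by
    have := (isProbabilityMeasure_Q hf hh).measure_univ
    rwa [Q, densityMeasure, withDensity_apply _ MeasurableSet.univ, setLIntegral_univ] at this

theorem IsSample.hasLaw_add {Ω : Type*} [MeasurableSpace Ω] {P : Measure Ω}
    [IsProbabilityMeasure P] {X ε : ℕ → Ω → ℝ} (hs : IsSample P (f 0) h X ε)
    (hf : IsDensity (f 0)) (hh : IsDensity h) (j : ℕ) :
    HasLaw (fun ω => X j ω + ε j ω) (Q f h 0) P where
  aemeasurable := (hs.law_signal j).aemeasurable.add (hs.law_noise j).aemeasurable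
  map_eq := by
    rw [Q_eq_conv hf hh, ← (hs.law_signal j).map_eq, ← (hs.law_noise j).map_eq]
    exact (hs.indep_signal_noise j).map_add_eq_map_conv_map₀ (hs.law_signal j).aemeasurable
      (hs.law_noise j).aemeasurable

theorem IsSample.iIndepFun_add {Ω : Type*} [MeasurableSpace Ω] {P : Measure Ω}
    {f₀ : ℝ → ℝ} {X ε : ℕ → Ω → ℝ} (hs : IsSample P f₀ h X ε) :
    iIndepFun (fun j ω => X j ω + ε j ω) P :=
  hs.indep.comp (fun _ z => z.1 + z.2) fun _ => measurable_fst.add measurable_snd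

end Density

/-! ### An `L²` convergence criterion and Hellinger increments -/

section QuadraticMean

variable {α : Type*} [MeasurableSpace α] {μ : Measure α}

/-- Expand `(z - v)² = z² - v² - 2v(z - v)`. The first entry of the minimum bounds the cross term
and tends to `0` with `z - v`; the second is an integrable majorant. When the second is the smaller,
`|z - v| ≥ 4g`, and half of the doubled square absorbs the cross term. -/
theorem sq_le_two_mul_sub_add_min {z v g : ℝ} (hv : |v| ≤ g) :
    (z - v) ^ 2 ≤ 2 * (z ^ 2 - v ^ 2) + 2 * min (2 * (g * |z - v|)) (8 * g ^ 2) := by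
  have hg : 0 ≤ g := (abs_nonneg v).trans hv
  have h1 : -(g * |z - v|) ≤ v * (z - v) := by
    have : |v * (z - v)| ≤ g * |z - v| := by
      rw [abs_mul]
      exact mul_le_mul_of_nonneg_right hv (abs_nonneg _)
    exact (abs_le.1 this).1
  have h2 : |z - v| ^ 2 = (z - v) ^ 2 := sq_abs _
  rcases min_cases (2 * (g * |z - v|)) (8 * g ^ 2) with h | h
  · rw [h.1]; nlinarith [sq_nonneg (z - v)]
  · rw [h.1]
    have h3 : 4 * g ≤ |z - v| := by
      by_contra hc
      push Not at hc
      nlinarith [h.2]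
    nlinarith [mul_nonneg hg (sub_nonneg.2 h3), mul_nonneg (abs_nonneg (z - v)) (sub_nonneg.2 h3)]

/-- A Riesz-type criterion: no domination of `Z` is needed, because the excess of `∫ Z²` over `∫ V²`
is controlled by `hle` and the remaining minimum is dominated by `8G²`. -/
theorem tendsto_integral_sub_sq {ι : Type*} {l : Filter ι} [l.IsCountablyGenerated]
    {Z V : ι → α → ℝ} {G : α → ℝ} (hZ : ∀ᶠ i in l, MemLp (Z i) 2 μ)
    (hV : ∀ᶠ i in l, MemLp (V i) 2 μ) (hG : MemLp G 2 μ) (hVG : ∀ i y, |V i y| ≤ G y)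
    (hlim : ∀ᵐ y ∂μ, G y ≠ 0 → Tendsto (fun i => Z i y - V i y) l (𝓝 0))
    (hle : ∀ ε > 0, ∀ᶠ i in l, ∫ y, Z i y ^ 2 ∂μ ≤ ∫ y, V i y ^ 2 ∂μ + ε) :
    Tendsto (fun i => ∫ y, (Z i y - V i y) ^ 2 ∂μ) l (𝓝 0) := by
  set M : ι → α → ℝ := fun i y => min (2 * (G y * |Z i y - V i y|)) (8 * G y ^ 2) with hM
  have hM_le (i : ι) (y : α) : ‖M i y‖ ≤ 8 * G y ^ 2 := by
    have hg : 0 ≤ G y := (abs_nonneg _).trans (hVG i y)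
    rw [Real.norm_eq_abs, abs_of_nonneg (by positivity)]
    exact min_le_right _ _
  have hM_meas : ∀ᶠ i in l, AEStronglyMeasurable (M i) μ := by
    filter_upwards [hZ, hV] with i hZi hVi
    have h1 := hZi.1.aemeasurable
    have h2 := hVi.1.aemeasurable
    have h3 := hG.1.aemeasurable
    have : AEMeasurable (fun y => |Z i y - V i y|) μ := (h1.sub h2).norm
    exact (((h3.mul this).const_mul 2).min ((h3.pow_const 2).const_mul 8)).aestronglyMeasurable
  have hM_int : Integrable (fun y => 8 * G y ^ 2) μ := hG.integrable_sq.const_mul 8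
  have hM_tendsto : Tendsto (fun i => ∫ y, M i y ∂μ) l (𝓝 0) := by
    have := tendsto_integral_filter_of_dominated_convergence (μ := μ) (l := l) (F := M)
      (f := fun _ => 0) _ hM_meas (Eventually.of_forall fun i => ae_of_all _ (hM_le i)) hM_int ?_
    · simpa using this
    filter_upwards [hlim] with y hy
    -- Where `G` vanishes so does the minimum, whatever `Z` does there.
    by_cases hGy : G y = 0
    · simpa [hM, hGy] using tendsto_const_nhds
    have h1 : Tendsto (fun i => 2 * (G y * |Z i y - V i y|)) l (𝓝 0) := by
      simpa using ((hy hGy).abs.const_mul (G y)).const_mul 2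
    have h2 := h1.min (tendsto_const_nhds (x := 8 * G y ^ 2))
    rwa [min_eq_left (by positivity)] at h2
  rw [Metric.tendsto_nhds]
  intro ε hε
  filter_upwards [hZ, hV, hM_meas, hle (ε / 8) (by positivity),
    (Metric.tendsto_nhds.1 hM_tendsto) (ε / 8) (by positivity)] with i hZi hVi hMi h1 h2
  rw [Real.dist_eq, sub_zero] at h2 ⊢
  rw [abs_of_nonneg (integral_nonneg fun y => sq_nonneg _)]
  have hMint : Integrable (M i) μ := hM_int.mono' hMi (ae_of_all _ (hM_le i))
  have h3 : ∫ y, (Z i y - V i y) ^ 2 ∂μ ≤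
      ∫ y, (2 * (Z i y ^ 2 - V i y ^ 2) + 2 * M i y) ∂μ :=
    integral_mono (hZi.sub hVi).integrable_sq
      (((hZi.integrable_sq.sub hVi.integrable_sq).const_mul 2).add (hMint.const_mul 2))
      fun y => sq_le_two_mul_sub_add_min (hVG i y)
  have h4 : ∫ y, (2 * (Z i y ^ 2 - V i y ^ 2) + 2 * M i y) ∂μ =
      2 * (∫ y, Z i y ^ 2 ∂μ - ∫ y, V i y ^ 2 ∂μ) + 2 * ∫ y, M i y ∂μ := by
    rw [← integral_sub hZi.integrable_sq hVi.integrable_sq, ← integral_const_mul,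
      ← integral_const_mul]
    exact integral_add ((hZi.integrable_sq.sub hVi.integrable_sq).const_mul 2) (hMint.const_mul 2)
  linarith [(abs_lt.1 h2).2]

variable {E : Type*} [NormedAddCommGroup E] [NormedSpace ℝ E]

/-- A zero of a nonnegative function on an open set is a local minimum. This makes the convention
`0/0 = 0` in the information integrand the right one. -/
theorem fderiv_eq_zero_of_nonneg {Θ : Set E} (hΘ : IsOpen Θ) {g : E → ℝ}
    (h0 : ∀ θ ∈ Θ, 0 ≤ g θ) {θ : E} (hθ : θ ∈ Θ) (hg : g θ = 0) : fderiv ℝ g θ = 0 := by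
  refine IsLocalMin.fderiv_eq_zero ?_
  filter_upwards [hΘ.mem_nhds hθ] with x hx
  rw [hg]
  exact h0 x hx

theorem measurable_fderiv_apply_of_isOpen {Θ : Set E} (hΘ : IsOpen Θ) {p : α → E → ℝ}
    (hm : ∀ θ ∈ Θ, Measurable fun y => p y θ) (hd : ∀ y, DifferentiableOn ℝ (p y) Θ)
    {θ : E} (hθ : θ ∈ Θ) (v : E) : Measurable fun y => fderiv ℝ (p y) θ v := by
  have hs : Tendsto (fun n : ℕ => ((n : ℝ) + 1)) atTop atTop :=
    tendsto_natCast_atTop_atTop.atTop_add tendsto_const_nhds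
  have hc : Tendsto (fun n : ℕ => θ + ((n : ℝ) + 1)⁻¹ • v) atTop (𝓝 θ) := by
    simpa using (hs.inv_tendsto_atTop.smul_const v).const_add θ
  obtain ⟨N, hN⟩ := eventually_atTop.1 (hc.eventually (hΘ.mem_nhds hθ))
  -- The derivative is a limit of difference quotients in `y`; the shift by `N` keeps every
  -- evaluation point inside `Θ`, where `p` is known to be measurable.
  refine measurable_of_tendsto_metrizable
    (f := fun n y => (((n + N : ℕ) : ℝ) + 1) •
      (p y (θ + (((n + N : ℕ) : ℝ) + 1)⁻¹ • v) - p y θ)) (fun n => ?_) ?_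
  · simp only [smul_eq_mul]
    exact ((hm _ (hN _ (Nat.le_add_left _ _))).sub (hm _ hθ)).const_mul _
  · refine tendsto_pi_nhds.2 fun y => ?_
    have hd' : HasFDerivAt (p y) (fderiv ℝ (p y) θ) θ :=
      ((hd y θ hθ).differentiableAt (hΘ.mem_nhds hθ)).hasFDerivAt
    exact (hd'.lim_real v).comp (hs.comp (tendsto_add_atTop_nat N))

/-- The variance of `r` under the uniform law on `[0, 1]` is nonnegative. -/
theorem sq_intervalIntegral_le {r : ℝ → ℝ} (hr : Continuous r) :
    (∫ t in (0 : ℝ)..1, r t) ^ 2 ≤ ∫ t in (0 : ℝ)..1, r t ^ 2 := by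
  set m := ∫ t in (0 : ℝ)..1, r t with hm
  have h : 0 ≤ ∫ t in (0 : ℝ)..1, (r t - m) ^ 2 :=
    intervalIntegral.integral_nonneg zero_le_one fun t _ => sq_nonneg _
  have h1 : ∫ t in (0 : ℝ)..1, (r t - m) ^ 2 = (∫ t in (0 : ℝ)..1, r t ^ 2) - m ^ 2 := by
    have : ∀ t, (r t - m) ^ 2 = r t ^ 2 - (2 * m) * r t + m ^ 2 := fun t => by ring
    simp_rw [this]
    rw [intervalIntegral.integral_add, intervalIntegral.integral_sub,
      intervalIntegral.integral_const_mul, ← hm]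
    · simp; ring
    all_goals exact Continuous.intervalIntegrable (by fun_prop) _ _
  linarith

theorem ofReal_sq_intervalIntegral_le {r : ℝ → ℝ} (hr : Continuous r) :
    ENNReal.ofReal ((∫ t in (0 : ℝ)..1, r t) ^ 2) ≤
      ∫⁻ t in Set.Ioc (0 : ℝ) 1, ENNReal.ofReal (r t ^ 2) := by
  refine (ENNReal.ofReal_le_ofReal (sq_intervalIntegral_le hr)).trans_eq ?_
  rw [intervalIntegral.integral_of_le zero_le_one, ofReal_integral_eq_lintegral_ofReal _
    (ae_of_all _ fun t => sq_nonneg _)]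
  exact ((hr.pow 2).intervalIntegrable 0 1).1

/-- The square root is not smooth at `0`, so `p` is lifted by `δ`. Then `√(p + δ)` is `C¹` along the
segment, and the fundamental theorem of calculus, Cauchy–Schwarz and Tonelli give a bound
independent of `δ`. -/
theorem lintegral_sqrt_add_sub_sq_le [SFinite μ] {Θ : Set E} (hΘ : IsOpen Θ) {p : α → E → ℝ}
    (hm : ∀ θ ∈ Θ, Measurable fun y => p y θ) (h0 : ∀ y, ∀ θ ∈ Θ, 0 ≤ p y θ)
    (hC : ∀ y, ContDiffOn ℝ 1 (p y) Θ) {a b : E} (hab : segment ℝ a b ⊆ Θ) {C : ENNReal}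
    (hbound : ∀ θ ∈ segment ℝ a b,
      ∫⁻ y, ENNReal.ofReal ((fderiv ℝ (p y) θ (b - a)) ^ 2 / (4 * p y θ)) ∂μ ≤ C)
    {δ : ℝ} (hδ : 0 < δ) :
    ∫⁻ y, ENNReal.ofReal ((√(p y b + δ) - √(p y a + δ)) ^ 2) ∂μ ≤ C := by
  -- Clamping `t` to `[0, 1]` keeps the path in `Θ` for every real `t`, so that the integrand `r` is
  -- continuous on the whole line.
  set γ : ℝ → E := fun t => AffineMap.lineMap a b (Set.projIcc (0 : ℝ) 1 zero_le_one t : ℝ) with hγ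
  have hγc : Continuous γ :=
    AffineMap.lineMap_continuous.comp (continuous_subtype_val.comp continuous_projIcc)
  have hγs (t : ℝ) : γ t ∈ segment ℝ a b := by
    rw [segment_eq_image_lineMap]
    exact ⟨_, (Set.projIcc (0 : ℝ) 1 zero_le_one t).2, rfl⟩
  set r : ℝ → α → ℝ := fun t y => fderiv ℝ (p y) (γ t) (b - a) / (2 * √(p y (γ t) + δ)) with hr
  have hpos (y : α) {θ : E} (hθ : θ ∈ Θ) : 0 < p y θ + δ := by linarith [h0 y θ hθ]
  have hrc (y : α) : Continuous fun t => r t y := by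
    have h1 : Continuous fun t => fderiv ℝ (p y) (γ t) :=
      ((hC y).continuousOn_fderiv_of_isOpen hΘ le_rfl).comp_continuous hγc fun t => hab (hγs t)
    have h2 : Continuous fun t => p y (γ t) :=
      (hC y).continuousOn.comp_continuous hγc fun t => hab (hγs t)
    refine (h1.clm_apply continuous_const).div ((h2.add_const δ).sqrt.const_mul 2) fun t => ?_
    have := Real.sqrt_pos.2 (hpos y (hab (hγs t)))
    positivity
  have hrm (t : ℝ) : Measurable (r t) := by
    refine (measurable_fderiv_apply_of_isOpen hΘ hm
      (fun y => (hC y).differentiableOn one_ne_zero) (hab (hγs t)) _).div ?_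
    exact (((hm _ (hab (hγs t))).add_const δ).sqrt).const_mul 2
  have hru : Measurable (Function.uncurry r) :=
    measurable_uncurry_of_continuous_of_measurable hrc hrm
  have hftc (y : α) : ∫ t in (0 : ℝ)..1, r t y = √(p y b + δ) - √(p y a + δ) := by
    have := intervalIntegral.integral_eq_sub_of_hasDerivAt (a := 0) (b := 1)
      (f := fun t => √(p y (AffineMap.lineMap a b t) + δ)) (f' := fun t => r t y) (fun t ht => ?_)
      ((hrc y).intervalIntegrable 0 1)
    · simpa using this
    rw [Set.uIcc_of_le zero_le_one] at ht
    have hγt : γ t = AffineMap.lineMap a b t := by rw [hγ]; simp [Set.projIcc_of_mem zero_le_one ht]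
    have hmem : AffineMap.lineMap a b t ∈ Θ := hγt ▸ hab (hγs t)
    have hd : HasFDerivAt (p y) (fderiv ℝ (p y) (AffineMap.lineMap a b t))
        (AffineMap.lineMap a b t) :=
      (((hC y).differentiableOn one_ne_zero _ hmem).differentiableAt
        (hΘ.mem_nhds hmem)).hasFDerivAt
    have := ((hd.comp_hasDerivAt t AffineMap.hasDerivAt_lineMap).add_const δ).sqrt
      (hpos y hmem).ne'
    simpa [hr, hγt] using this
  have hrle (t : ℝ) (y : α) :
      r t y ^ 2 ≤ (fderiv ℝ (p y) (γ t) (b - a)) ^ 2 / (4 * p y (γ t)) := by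
    have hp := hpos y (hab (hγs t))
    rw [hr]
    simp only [div_pow, mul_pow, Real.sq_sqrt hp.le]
    -- If `p = 0` the derivative vanishes and both sides are `0`; otherwise dropping `δ` shrinks the
    -- denominator.
    rcases (h0 y _ (hab (hγs t))).eq_or_lt with h | h
    · simp [fderiv_eq_zero_of_nonneg hΘ (h0 y) (hab (hγs t)) h.symm]
    · gcongr
      · norm_num
      · linarith
  calc ∫⁻ y, ENNReal.ofReal ((√(p y b + δ) - √(p y a + δ)) ^ 2) ∂μ
      ≤ ∫⁻ y, (∫⁻ t in Set.Ioc (0 : ℝ) 1, ENNReal.ofReal (r t y ^ 2)) ∂μ := by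
        refine lintegral_mono fun y => ?_
        rw [← hftc y]
        exact ofReal_sq_intervalIntegral_le (hrc y)
    _ = ∫⁻ t in Set.Ioc (0 : ℝ) 1, ∫⁻ y, ENNReal.ofReal (r t y ^ 2) ∂μ :=
        lintegral_lintegral_swap
          ((hru.comp measurable_swap).pow_const 2).ennreal_ofReal.aemeasurable
    _ ≤ ∫⁻ _ in Set.Ioc (0 : ℝ) 1, C :=
        lintegral_mono fun t => (lintegral_mono fun y =>
          ENNReal.ofReal_le_ofReal (hrle t y)).trans (hbound _ (hγs t))
    _ = C := by simp

/-- Let `δ = 1/(n + 1)` tend to `0` and apply Fatou's lemma. -/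
theorem lintegral_sqrt_sub_sq_le_of_forall [SFinite μ] {Θ : Set E} (hΘ : IsOpen Θ)
    {p : α → E → ℝ}
    (hm : ∀ θ ∈ Θ, Measurable fun y => p y θ) (h0 : ∀ y, ∀ θ ∈ Θ, 0 ≤ p y θ)
    (hC : ∀ y, ContDiffOn ℝ 1 (p y) Θ) {a b : E} (hab : segment ℝ a b ⊆ Θ) {C : ENNReal}
    (hbound : ∀ θ ∈ segment ℝ a b,
      ∫⁻ y, ENNReal.ofReal ((fderiv ℝ (p y) θ (b - a)) ^ 2 / (4 * p y θ)) ∂μ ≤ C) :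
    ∫⁻ y, ENNReal.ofReal ((√(p y b) - √(p y a)) ^ 2) ∂μ ≤ C := by
  have ha := hm _ (hab (left_mem_segment ℝ a b))
  have hb := hm _ (hab (right_mem_segment ℝ a b))
  have hδ (n : ℕ) : 0 < 1 / ((n : ℝ) + 1) := by positivity
  calc ∫⁻ y, ENNReal.ofReal ((√(p y b) - √(p y a)) ^ 2) ∂μ
      = ∫⁻ y, liminf (fun n : ℕ => ENNReal.ofReal ((√(p y b + 1 / ((n : ℝ) + 1)) -
          √(p y a + 1 / ((n : ℝ) + 1))) ^ 2)) atTop ∂μ := by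
        refine lintegral_congr fun y => (Tendsto.liminf_eq ?_).symm
        have hc : Continuous fun δ : ℝ =>
            ENNReal.ofReal ((√(p y b + δ) - √(p y a + δ)) ^ 2) :=
          ENNReal.continuous_ofReal.comp (by fun_prop)
        simpa [Function.comp_def] using
          (hc.tendsto 0).comp (tendsto_one_div_add_atTop_nhds_zero_nat (𝕜 := ℝ))
    _ ≤ liminf (fun n : ℕ => ∫⁻ y, ENNReal.ofReal ((√(p y b + 1 / ((n : ℝ) + 1)) -
          √(p y a + 1 / ((n : ℝ) + 1))) ^ 2) ∂μ) atTop :=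
        lintegral_liminf_le fun n =>
          (((hb.add_const _).sqrt.sub (ha.add_const _).sqrt).pow_const 2).ennreal_ofReal
    _ ≤ C := by
        refine (liminf_le_liminf (Eventually.of_forall fun n =>
          lintegral_sqrt_add_sub_sq_le hΘ hm h0 hC hab hbound (hδ n))).trans_eq ?_
        simp

/-- The squared Hellinger increment along a segment is controlled by the Fisher information
in the direction of the segment. -/
theorem lintegral_sqrt_sub_sq_le [SFinite μ] {Θ : Set E} (hΘ : IsOpen Θ) {p : α → E → ℝ}
    (hm : ∀ θ ∈ Θ, Measurable fun y => p y θ) (h0 : ∀ y, ∀ θ ∈ Θ, 0 ≤ p y θ)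
    (hC : ∀ᵐ y ∂μ, ContDiffOn ℝ 1 (p y) Θ) {a b : E} (hab : segment ℝ a b ⊆ Θ) {C : ENNReal}
    (hbound : ∀ θ ∈ segment ℝ a b,
      ∫⁻ y, ENNReal.ofReal ((fderiv ℝ (p y) θ (b - a)) ^ 2 / (4 * p y θ)) ∂μ ≤ C) :
    ∫⁻ y, ENNReal.ofReal ((√(p y b) - √(p y a)) ^ 2) ∂μ ≤ C := by
  classical
  -- Replacing `p` by `0` off a measurable conull set makes smoothness hold for every `y` without
  -- changing any integral.
  obtain ⟨N, hN, hNm, hNC⟩ := hC.exists_measurable_mem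
  set p' : α → E → ℝ := fun y θ => if y ∈ N then p y θ else 0 with hp'
  have hpN {y : α} (hy : y ∈ N) : p' y = p y := by ext θ; simp [hp', hy]
  have hpN' {y : α} (hy : y ∉ N) : p' y = fun _ => 0 := by ext θ; simp [hp', hy]
  have hae : ∀ᵐ y ∂μ, p' y = p y := by filter_upwards [hN] with y hy using hpN hy
  have key := lintegral_sqrt_sub_sq_le_of_forall (μ := μ) (p := p') (C := C) hΘ
    (fun θ hθ => Measurable.ite hNm (hm θ hθ) measurable_const)
    (fun y θ hθ => by by_cases hy : y ∈ N <;> simp [hp', hy, h0 y θ hθ])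
    (fun y => by
      by_cases hy : y ∈ N
      · rw [hpN hy]; exact hNC y hy
      · rw [hpN' hy]; exact contDiffOn_const) hab
    (fun θ hθ => by
      refine (lintegral_congr_ae ?_).trans_le (hbound θ hθ)
      filter_upwards [hae] with y hy
      rw [hy])
  refine (lintegral_congr_ae ?_).trans_le key
  filter_upwards [hae] with y hy
  rw [hy]

end QuadraticMean

/-! ### Differentiability in quadratic mean -/

section QuadraticMean

variable {α : Type*} [MeasurableSpace α] {μ : Measure α}
variable {E : Type*} [NormedAddCommGroup E] [NormedSpace ℝ E]

/-- Quadratic mean differentiability of `θ ↦ √p(·; θ)` for a pointwise continuously differentiable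
family with upper semicontinuous Fisher information. -/
theorem tendsto_integral_sqrt_sub_sub_fderiv_sq [SFinite μ] {Θ : Set E} (hΘ : IsOpen Θ)
    {p : α → E → ℝ} (hm : ∀ θ ∈ Θ, Measurable fun y => p y θ) (h0 : ∀ y, ∀ θ ∈ Θ, 0 ≤ p y θ)
    (hC : ∀ᵐ y ∂μ, ContDiffOn ℝ 1 (p y) Θ) {θ₀ : E} (hθ₀ : θ₀ ∈ Θ)
    (hp : ∀ θ ∈ Θ, MemLp (fun y => √(p y θ)) 2 μ)
    (hV : ∀ v, AEStronglyMeasurable (fun y => fderiv ℝ (p y) θ₀ v / (2 * √(p y θ₀))) μ)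
    (hG : MemLp (fun y => ‖fderiv ℝ (p y) θ₀‖ / (2 * √(p y θ₀))) 2 μ)
    (hle : ∀ ε > 0, ∀ᶠ θ in 𝓝 θ₀, ∀ v : E,
      ∫⁻ y, ENNReal.ofReal ((fderiv ℝ (p y) θ v) ^ 2 / (4 * p y θ)) ∂μ ≤
        ENNReal.ofReal (∫ y, (fderiv ℝ (p y) θ₀ v) ^ 2 / (4 * p y θ₀) ∂μ + ε * ‖v‖ ^ 2)) :
    Tendsto (fun θ => ∫ y, (‖θ - θ₀‖⁻¹ * (√(p y θ) - √(p y θ₀)) -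
      ‖θ - θ₀‖⁻¹ * (fderiv ℝ (p y) θ₀ (θ - θ₀) / (2 * √(p y θ₀)))) ^ 2 ∂μ) (𝓝[≠] θ₀) (𝓝 0) := by
  have hΘ₀ : ∀ᶠ θ in 𝓝[≠] θ₀, θ ∈ Θ := eventually_nhdsWithin_of_eventually_nhds (hΘ.mem_nhds hθ₀)
  have hVG (θ : E) (y : α) : |‖θ - θ₀‖⁻¹ * (fderiv ℝ (p y) θ₀ (θ - θ₀) / (2 * √(p y θ₀)))| ≤
      ‖fderiv ℝ (p y) θ₀‖ / (2 * √(p y θ₀)) := by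
    rw [abs_mul, abs_div, abs_of_nonneg (by positivity : 0 ≤ 2 * √(p y θ₀)),
      abs_of_nonneg (by positivity : 0 ≤ ‖θ - θ₀‖⁻¹), ← mul_div_assoc]
    refine div_le_div_of_nonneg_right ?_ (by positivity)
    rcases eq_or_ne ‖θ - θ₀‖ 0 with h | h
    · simp [h]
    · rw [inv_mul_le_iff₀ (lt_of_le_of_ne (norm_nonneg _) h.symm), mul_comm]
      exact (fderiv ℝ (p y) θ₀).le_opNorm _
  have hVL (v : E) : MemLp (fun y => fderiv ℝ (p y) θ₀ v / (2 * √(p y θ₀))) 2 μ := by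
    refine (hG.const_mul ‖v‖).mono (hV v) (ae_of_all _ fun y => ?_)
    rw [norm_div, norm_mul ‖v‖, norm_div, norm_norm, norm_norm, ← mul_div_assoc, mul_comm ‖v‖]
    exact div_le_div_of_nonneg_right ((fderiv ℝ (p y) θ₀).le_opNorm v) (norm_nonneg _)
  refine tendsto_integral_sub_sq (G := fun y => ‖fderiv ℝ (p y) θ₀‖ / (2 * √(p y θ₀)))
    ?_ ?_ hG hVG ?_ ?_
  · filter_upwards [hΘ₀] with θ hθ
    exact ((hp θ hθ).sub (hp θ₀ hθ₀)).const_mul _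
  · exact Eventually.of_forall fun θ => (hVL _).const_mul _
  · filter_upwards [hC] with y hy hGy
    -- Division by zero gives `0`, so `G y ≠ 0` forces `p y θ₀ ≠ 0`, where the square root is
    -- differentiable.
    have hpy : p y θ₀ ≠ 0 := fun h => hGy (by simp [h])
    have hd : HasFDerivAt (p y) (fderiv ℝ (p y) θ₀) θ₀ :=
      ((hy.differentiableOn one_ne_zero _ hθ₀).differentiableAt (hΘ.mem_nhds hθ₀)).hasFDerivAt
    have h1 := (hasFDerivAt_iff_tendsto.1 (hd.sqrt hpy)).mono_left
      (nhdsWithin_le_nhds (s := {θ₀}ᶜ))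
    refine (tendsto_zero_iff_norm_tendsto_zero.2 (h1.congr fun θ => ?_))
    rw [← mul_sub, norm_mul, norm_inv, norm_norm]
    simp only [one_div, smul_apply, smul_eq_mul]
    rw [inv_mul_eq_div _ (fderiv ℝ (p y) θ₀ (θ - θ₀))]
  · intro ε hε
    obtain ⟨r, hr, hball⟩ := Metric.eventually_nhds_iff_ball.1
      ((hle ε hε).and (hΘ.eventually_mem hθ₀))
    filter_upwards [nhdsWithin_le_nhds (Metric.ball_mem_nhds θ₀ hr), self_mem_nhdsWithin]
      with θ hθ hne
    have hne' : ‖θ - θ₀‖ ≠ 0 := norm_ne_zero_iff.2 (sub_ne_zero.2 hne)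
    -- Balls are convex, so the information bound holds along the whole segment; being uniform in
    -- the direction, it may be used with `v = θ - θ₀`.
    have hseg : segment ℝ θ₀ θ ⊆ Metric.ball θ₀ r :=
      (convex_ball θ₀ r).segment_subset (Metric.mem_ball_self hr) hθ
    have key := lintegral_sqrt_sub_sq_le (μ := μ) hΘ hm h0 hC
      (fun x hx => (hball x (hseg hx)).2) (fun x hx => (hball x (hseg hx)).1 (θ - θ₀))
    have hZ : MemLp (fun y => √(p y θ) - √(p y θ₀)) 2 μ := (hp θ (hball θ hθ).2).sub (hp θ₀ hθ₀)
    rw [← ofReal_integral_eq_lintegral_ofReal hZ.integrable_sq (ae_of_all _ fun y => sq_nonneg _),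
      ENNReal.ofReal_le_ofReal_iff] at key
    · simp only [mul_pow]
      rw [integral_const_mul, integral_const_mul]
      have h2 : ∫ y, (fderiv ℝ (p y) θ₀ (θ - θ₀) / (2 * √(p y θ₀))) ^ 2 ∂μ =
          ∫ y, (fderiv ℝ (p y) θ₀ (θ - θ₀)) ^ 2 / (4 * p y θ₀) ∂μ := by
        congr 1 with y
        rw [div_pow, mul_pow, Real.sq_sqrt (h0 y θ₀ hθ₀)]
        norm_num
      rw [h2]
      have h3 := mul_le_mul_of_nonneg_left key (by positivity : 0 ≤ ‖θ - θ₀‖⁻¹ ^ 2)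
      refine h3.trans_eq ?_
      field_simp
    · exact add_nonneg (integral_nonneg fun y => div_nonneg (sq_nonneg _)
        (mul_nonneg (by norm_num) (h0 y _ hθ₀))) (by positivity)

end QuadraticMean

/-! ### The score and the Fisher information -/

section Score

variable {k : ℕ} {Θ : Set (EuclideanSpace ℝ (Fin k))} {f : EuclideanSpace ℝ (Fin k) → ℝ → ℝ}
  {h : ℝ → ℝ} {θ : EuclideanSpace ℝ (Fin k)}

/-- The indicator in the score is redundant because `0⁻¹ = 0`. -/
theorem score_eq_inv_smul (hf : IsDensity (f θ)) (hh : IsDensity h) (y : ℝ) :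
    score f h y θ = (q f h y θ)⁻¹ • gradient (fun θ' => q f h y θ') θ := by
  rw [score]
  split_ifs with hq
  · rfl
  · rw [le_antisymm (not_lt.1 hq) (q_nonneg hf hh y)]
    simp

theorem norm_score_sq_mul_q (hf : IsDensity (f θ)) (hh : IsDensity h) (y : ℝ) :
    ‖score f h y θ‖ ^ 2 * q f h y θ = ‖fderiv ℝ (q f h y) θ‖ ^ 2 / q f h y θ := by
  have hn : ‖gradient (fun θ' => q f h y θ') θ‖ = ‖fderiv ℝ (q f h y) θ‖ :=
    LinearIsometryEquiv.norm_map _ _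
  rw [score_eq_inv_smul hf hh, norm_smul, hn, norm_inv, mul_pow, inv_pow, Real.norm_eq_abs, sq_abs]
  rcases eq_or_ne (q f h y θ) 0 with h0 | h0
  · simp [h0]
  · field_simp

theorem inner_score_sq_mul_q (hf : IsDensity (f θ)) (hh : IsDensity h) (y : ℝ)
    (v : EuclideanSpace ℝ (Fin k)) :
    inner ℝ v (score f h y θ) ^ 2 * q f h y θ = fderiv ℝ (q f h y) θ v ^ 2 / q f h y θ := by
  rw [score_eq_inv_smul hf hh, real_inner_smul_right, real_inner_comm, inner_gradient_left]
  rcases eq_or_ne (q f h y θ) 0 with h0 | h0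
  · simp [h0]
  · field_simp

theorem half_inner_score_mul_sqrt (hf : IsDensity (f θ)) (hh : IsDensity h) (y : ℝ)
    (v : EuclideanSpace ℝ (Fin k)) :
    1 / 2 * inner ℝ v (score f h y θ) * √(q f h y θ) =
      fderiv ℝ (q f h y) θ v / (2 * √(q f h y θ)) := by
  rw [score_eq_inv_smul hf hh, real_inner_smul_right, real_inner_comm, inner_gradient_left]
  rcases (q_nonneg hf hh y).eq_or_lt with h0 | h0
  · simp [← h0]
  · have h1 := Real.sqrt_pos.2 h0
    have h2 := Real.sq_sqrt h0.le
    field_simp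
    rw [h2, mul_comm]

theorem integral_inner_score_sq (hs : MemLp (fun y => score f h y θ) 2 (Q f h θ))
    (v : EuclideanSpace ℝ (Fin k)) :
    ∫ y, inner ℝ v (score f h y θ) ^ 2 ∂(Q f h θ) =
      ∑ i, ∑ j, v i * v j * fisherInformation f h θ i j := by
  have hc (i : Fin k) : MemLp (fun y => score f h y θ i) 2 (Q f h θ) :=
    (EuclideanSpace.proj (𝕜 := ℝ) i).comp_memLp' hs
  have hi (i j : Fin k) :
      Integrable (fun y => v i * v j * (score f h y θ i * score f h y θ j)) (Q f h θ) :=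
    ((hc i).integrable_mul (hc j)).const_mul _
  simp only [fisherInformation, Matrix.of_apply, ← integral_const_mul]
  simp_rw [← integral_finsetSum _ fun j _ => hi _ j]
  rw [← integral_finsetSum _ fun i _ => integrable_finsetSum _ fun j _ => hi i j]
  congr 1 with y
  rw [PiLp.inner_apply, sq, Finset.sum_mul_sum]
  refine Finset.sum_congr rfl fun i _ => Finset.sum_congr rfl fun j _ => ?_
  simp
  ring

theorem integrable_inner_score_sq (hs : MemLp (fun y => score f h y θ) 2 (Q f h θ))
    (v : EuclideanSpace ℝ (Fin k)) :
    Integrable (fun y => inner ℝ v (score f h y θ) ^ 2) (Q f h θ) :=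
  (hs.const_inner v).integrable_sq

theorem lintegral_fderiv_sq_div (hf : IsDensity (f θ)) (hh : IsDensity h)
    (hs : MemLp (fun y => score f h y θ) 2 (Q f h θ)) (v : EuclideanSpace ℝ (Fin k)) :
    ∫⁻ y, ENNReal.ofReal (fderiv ℝ (q f h y) θ v ^ 2 / (4 * q f h y θ)) =
      ENNReal.ofReal ((∑ i, ∑ j, v i * v j * fisherInformation f h θ i j) / 4) ∧
    ∫ y, fderiv ℝ (q f h y) θ v ^ 2 / (4 * q f h y θ) =
      (∑ i, ∑ j, v i * v j * fisherInformation f h θ i j) / 4 := by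
  have heq (y : ℝ) : fderiv ℝ (q f h y) θ v ^ 2 / (4 * q f h y θ) =
      (inner ℝ v (score f h y θ) ^ 2 * q f h y θ) / 4 := by
    rw [inner_score_sq_mul_q hf hh, div_div, mul_comm 4]
  have hint := ((integrable_densityMeasure_iff (measurable_q hf hh) (q_nonneg hf hh) _).1
    (integrable_inner_score_sq hs v)).div_const 4
  have hval : ∫ y, fderiv ℝ (q f h y) θ v ^ 2 / (4 * q f h y θ) =
      (∑ i, ∑ j, v i * v j * fisherInformation f h θ i j) / 4 := by
    simp_rw [heq]
    rw [integral_div, ← integral_inner_score_sq hs, Q,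
      integral_densityMeasure (measurable_q hf hh) (q_nonneg hf hh)]
    simp_rw [mul_comm]
  refine ⟨?_, hval⟩
  rw [← hval, ofReal_integral_eq_lintegral_ofReal]
  · simpa only [heq] using hint
  · exact ae_of_all _ fun y => div_nonneg (sq_nonneg _) (mul_nonneg (by norm_num) (q_nonneg hf hh y))

theorem memLp_sqrt_q (hf : IsDensity (f θ)) (hh : IsDensity h) :
    MemLp (fun y => √(q f h y θ)) 2 := by
  have hd := isDensity_q hf hh
  rw [memLp_two_iff_integrable_sq hd.measurable.sqrt.aestronglyMeasurable]
  simpa only [Real.sq_sqrt (hd.nonneg _)] using hd.integrable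

theorem aestronglyMeasurable_q_smul (hf : IsDensity (f θ)) (hh : IsDensity h)
    {F : Type*} [NormedAddCommGroup F] [NormedSpace ℝ F] {g : ℝ → F}
    (hg : AEStronglyMeasurable g (Q f h θ)) :
    AEStronglyMeasurable (fun y => q f h y θ • g y) volume := by
  have := (aestronglyMeasurable_withDensity_iff (measurable_q hf hh).real_toNNReal).1 hg
  simpa only [Real.coe_toNNReal _ (q_nonneg hf hh _)] using this

theorem IsRegular.q_smul_score (hreg : IsRegular Θ f h) (hθ : θ ∈ Θ) (y : ℝ) :
    q f h y θ • score f h y θ = gradient (fun θ' => q f h y θ') θ := by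
  rw [score_eq_inv_smul (hreg.density θ hθ) hreg.noise.isDensity, smul_smul]
  rcases eq_or_ne (q f h y θ) 0 with h0 | h0
  · have := fderiv_eq_zero_of_nonneg hreg.isOpen
      (fun x hx => q_nonneg (hreg.density x hx) hreg.noise.isDensity y) hθ h0
    simp [gradient, this]
  · rw [mul_inv_cancel₀ h0, one_smul]

/-- The score is measurable only up to `Q_θ`-null sets, which may be large inside `{q = 0}`.
Multiplying by `q` gives Lebesgue measurability, and the product is the gradient even where `q = 0`.
-/
theorem IsRegular.aestronglyMeasurable_gradient (hreg : IsRegular Θ f h) (hθ : θ ∈ Θ) :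
    AEStronglyMeasurable (fun y => gradient (fun θ' => q f h y θ') θ) volume := by
  simp_rw [← hreg.q_smul_score hθ]
  exact aestronglyMeasurable_q_smul (hreg.density θ hθ) hreg.noise.isDensity
    (hreg.memLp_score θ hθ).1

theorem sum_mul_le_sum_abs_mul_norm_sq (A : Matrix (Fin k) (Fin k) ℝ)
    (v : EuclideanSpace ℝ (Fin k)) :
    ∑ i, ∑ j, v i * v j * A i j ≤ (∑ i, ∑ j, |A i j|) * ‖v‖ ^ 2 := by
  simp only [Finset.sum_mul]
  refine Finset.sum_le_sum fun i _ => Finset.sum_le_sum fun j _ => ?_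
  refine (le_abs_self _).trans ?_
  rw [abs_mul, abs_mul, mul_comm |A i j|]
  gcongr
  rw [sq]
  exact mul_le_mul (PiLp.norm_apply_le v i) (PiLp.norm_apply_le v j) (abs_nonneg _) (norm_nonneg _)

/-- Entrywise continuity of `I` bounds the quadratic form of `I(θ') - I(θ)` by `ε‖v‖²` uniformly in
`v`. -/
theorem IsRegular.eventually_information_le (hreg : IsRegular Θ f h) (hθ : θ ∈ Θ) {ε : ℝ}
    (hε : 0 < ε) : ∀ᶠ θ' in 𝓝 θ, ∀ v : EuclideanSpace ℝ (Fin k),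
      ∑ i, ∑ j, v i * v j * fisherInformation f h θ' i j ≤
        ∑ i, ∑ j, v i * v j * fisherInformation f h θ i j + ε * ‖v‖ ^ 2 := by
  have hc : ContinuousAt (fisherInformation f h) θ :=
    hreg.continuous_information.continuousAt (hreg.isOpen.mem_nhds hθ)
  have hc' : ContinuousAt (fun θ' => ∑ i, ∑ j,
      |(fisherInformation f h θ' - fisherInformation f h θ) i j|) θ := by
    have hcont : Continuous fun A : Matrix (Fin k) (Fin k) ℝ =>
        ∑ i, ∑ j, |(A - fisherInformation f h θ) i j| := by
      simp only [Matrix.sub_apply]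
      fun_prop
    exact hcont.continuousAt.comp hc
  have hlt : ∀ᶠ θ' in 𝓝 θ, ∑ i, ∑ j,
      |(fisherInformation f h θ' - fisherInformation f h θ) i j| < ε :=
    hc'.eventually (gt_mem_nhds (by simpa using hε))
  filter_upwards [hlt] with θ' hθ' v
  have h1 := sum_mul_le_sum_abs_mul_norm_sq
    (fisherInformation f h θ' - fisherInformation f h θ) v
  simp only [Matrix.sub_apply, mul_sub, Finset.sum_sub_distrib] at h1 hθ'
  have h2 := mul_le_mul_of_nonneg_right hθ'.le (sq_nonneg ‖v‖)
  linarith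

theorem IsRegular.tendsto_integral_score_sq (hreg : IsRegular Θ f h) (hθ : θ ∈ Θ) :
    Tendsto (fun θ' => ∫ y, (‖θ' - θ‖⁻¹ * (√(q f h y θ') - √(q f h y θ) -
      1 / 2 * inner ℝ (θ' - θ) (score f h y θ) * √(q f h y θ))) ^ 2) (𝓝[≠] θ) (𝓝 0) := by
  have hh := hreg.noise.isDensity
  have hf := hreg.density
  have hs := hreg.memLp_score
  have hg := hreg.aestronglyMeasurable_gradient hθ
  have hden : AEStronglyMeasurable (fun y => (2 * √(q f h y θ))⁻¹) volume :=
    ((measurable_q (hf θ hθ) hh).sqrt.const_mul 2).inv.aestronglyMeasurable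
  have key := tendsto_integral_sqrt_sub_sub_fderiv_sq (μ := volume) hreg.isOpen (p := q f h)
    (fun θ hθ => measurable_q (hf θ hθ) hh) (fun y θ hθ => q_nonneg (hf θ hθ) hh y)
    hreg.contDiff hθ (fun θ hθ => memLp_sqrt_q (hf θ hθ) hh) (fun v => ?_) ?_ ?_
  · refine key.congr fun θ' => ?_
    congr 1 with y
    rw [half_inner_score_mul_sqrt (hf θ hθ) hh, ← mul_sub]
  · have h1 : ∀ y, fderiv ℝ (q f h y) θ v / (2 * √(q f h y θ)) =
        inner ℝ (gradient (fun θ' => q f h y θ') θ) v * (2 * √(q f h y θ))⁻¹ := fun y => by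
      rw [inner_gradient_left, div_eq_mul_inv]
    simp_rw [h1]
    exact (hg.inner aestronglyMeasurable_const).mul hden
  · have h1 : ∀ y, ‖fderiv ℝ (q f h y) θ‖ = ‖gradient (fun θ' => q f h y θ') θ‖ := fun y =>
      (LinearIsometryEquiv.norm_map _ _).symm
    rw [memLp_two_iff_integrable_sq]
    · have h2 := ((integrable_densityMeasure_iff (measurable_q (hf θ hθ) hh)
        (q_nonneg (hf θ hθ) hh) _).1 (hs θ hθ).norm.integrable_sq).div_const 4
      refine h2.congr (ae_of_all _ fun y => ?_)
      simp only
      rw [norm_score_sq_mul_q (hf θ hθ) hh, div_pow, mul_pow, Real.sq_sqrt (q_nonneg (hf θ hθ) hh y),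
        div_div, mul_comm (q f h y θ)]
      norm_num
    · simp_rw [h1, div_eq_mul_inv]
      exact hg.norm.mul hden
  · intro ε hε
    filter_upwards [hreg.isOpen.mem_nhds hθ,
      hreg.eventually_information_le hθ (ε := 4 * ε) (by positivity)] with θ' hθ' hle v
    rw [(lintegral_fderiv_sq_div (hf θ' hθ') hh (hs θ' hθ') v).1,
      (lintegral_fderiv_sq_div (hf θ hθ) hh (hs θ hθ) v).2]
    refine ENNReal.ofReal_le_ofReal ?_
    linarith [hle v]

theorem IsRegular.memLp_half_inner_score (hreg : IsRegular Θ f h) (hθ : θ ∈ Θ)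
    (v : EuclideanSpace ℝ (Fin k)) :
    MemLp (fun y => 1 / 2 * inner ℝ v (score f h y θ) * √(q f h y θ)) 2 := by
  have hh := hreg.noise.isDensity
  have hf := hreg.density θ hθ
  have hs := hreg.memLp_score θ hθ
  rw [memLp_two_iff_integrable_sq]
  · have h2 := ((integrable_densityMeasure_iff (measurable_q hf hh) (q_nonneg hf hh) _).1
      (integrable_inner_score_sq hs v)).div_const 4
    refine h2.congr (ae_of_all _ fun y => ?_)
    simp only [mul_pow, Real.sq_sqrt (q_nonneg hf hh y)]
    ring
  · have h1 : ∀ y, 1 / 2 * inner ℝ v (score f h y θ) * √(q f h y θ) =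
        inner ℝ (gradient (fun θ' => q f h y θ') θ) v * (2 * √(q f h y θ))⁻¹ := fun y => by
      rw [half_inner_score_mul_sqrt hf hh, inner_gradient_left, div_eq_mul_inv]
    simp_rw [h1]
    exact ((hreg.aestronglyMeasurable_gradient hθ).inner aestronglyMeasurable_const).mul
      ((measurable_q hf hh).sqrt.const_mul 2).inv.aestronglyMeasurable

theorem IsRegular.isQuadraticMeanScore (hreg : IsRegular Θ f h) (hθ : θ ∈ Θ) :
    IsQuadraticMeanScore f h θ (fun y => score f h y θ) := by
  refine ⟨hreg.memLp_score θ hθ, ?_⟩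
  have hh := hreg.noise.isDensity
  -- The square root of the integral is the `L²` norm, from which the factor `‖θ' - θ‖⁻¹` is then
  -- pulled out.
  have h1 := (hreg.tendsto_integral_score_sq hθ).rpow_const (p := (2 : ℝ)⁻¹)
    (Or.inr (by norm_num))
  rw [Real.zero_rpow (by norm_num)] at h1
  have h2 := ENNReal.tendsto_ofReal h1
  rw [ENNReal.ofReal_zero] at h2
  refine h2.congr' ?_
  filter_upwards [nhdsWithin_le_nhds (hreg.isOpen.mem_nhds hθ), self_mem_nhdsWithin]
    with θ' hθ' hne
  have hne' : θ' - θ ≠ 0 := sub_ne_zero.2 hne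
  have hD := ((memLp_sqrt_q (hreg.density θ' hθ') hh).sub
    (memLp_sqrt_q (hreg.density θ hθ) hh)).sub (hreg.memLp_half_inner_score hθ (θ' - θ))
  have h3 := (hD.const_mul ‖θ' - θ‖⁻¹).eLpNorm_eq_integral_rpow_norm two_ne_zero
    ENNReal.ofNat_ne_top
  simp only [ENNReal.toReal_ofNat, Real.rpow_ofNat, Real.norm_eq_abs, sq_abs, Pi.sub_apply] at h3
  rw [← h3]
  have h4 := eLpNorm_const_smul (‖θ' - θ‖⁻¹ : ℝ) (fun y => √(q f h y θ') - √(q f h y θ)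
      - 1 / 2 * inner ℝ (θ' - θ) (score f h y θ) * √(q f h y θ)) 2 volume
  have h5 : ‖(‖θ' - θ‖⁻¹ : ℝ)‖ₑ = ‖θ' - θ‖ₑ⁻¹ := by
    rw [enorm_inv (norm_ne_zero_iff.2 hne'), enorm_norm]
  rw [h5] at h4
  rw [ENNReal.div_eq_inv_mul, ← h4]
  rfl

end Score

/-! ### The multivariate central limit theorem -/

section CentralLimit

variable {E : Type*} [NormedAddCommGroup E] [InnerProductSpace ℝ E] [FiniteDimensional ℝ E]
  [MeasurableSpace E] [BorelSpace E] {Ω : Type*} [MeasurableSpace Ω] {P : Measure Ω}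
  [IsProbabilityMeasure P]

/-- Cramér–Wold: the projections on the unit vector `t/‖t‖` are centred with variance `1`, and the
characteristic function at `t` is that of their normalized sum at `‖t‖`. -/
theorem tendsto_charFun_inv_sqrt_smul_sum {X : ℕ → Ω → E} (hindep : iIndepFun X P)
    (hident : ∀ i, IdentDistrib (X i) (X 0) P P)
    (hmean : ∀ t : E, ∫ ω, inner ℝ t (X 0 ω) ∂P = 0)
    (hvar : ∀ t : E, ∫ ω, inner ℝ t (X 0 ω) ^ 2 ∂P = ‖t‖ ^ 2) (t : E) :
    Tendsto (fun n : ℕ => charFun (P.map fun ω => (√(n : ℝ))⁻¹ • ∑ j ∈ Finset.range n, X j ω) t)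
      atTop (𝓝 (charFun (stdGaussian E) t)) := by
  rw [charFun_stdGaussian]
  by_cases ht : t = 0
  · subst ht
    simp only [charFun_zero]
    have (n : ℕ) : IsProbabilityMeasure
        (P.map fun ω => (√(n : ℝ))⁻¹ • ∑ j ∈ Finset.range n, X j ω) :=
      Measure.isProbabilityMeasure_map
        ((Finset.aemeasurable_fun_sum _ fun j _ => (hident j).aemeasurable_fst).const_smul _)
    simp
  have ht' : ‖t‖ ≠ 0 := norm_ne_zero_iff.2 ht
  have hm : Measurable fun x : E => inner ℝ (‖t‖⁻¹ • t) x := by fun_prop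
  have hY := tendsto_charFun_inv_sqrt_mul_pow (P := P)
    (X := fun ω => inner ℝ (‖t‖⁻¹ • t) (X 0 ω)) (hm.comp_aemeasurable (hident 0).aemeasurable_fst)
    (hmean _) (by simp [hvar, norm_smul, ht']) ‖t‖
  refine hY.congr fun n => ?_
  rw [← charFun_inv_sqrt_mul_sum (X := fun j ω => inner ℝ (‖t‖⁻¹ • t) (X j ω))
    (hindep.comp (fun _ x => inner ℝ (‖t‖⁻¹ • t) x) fun _ => hm)
    (fun i => (hident i).comp hm)]
  have hX (j : ℕ) := (hident j).aemeasurable_fst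
  rw [charFun_apply, charFun_apply, integral_map (by fun_prop) (by fun_prop),
    integral_map (by fun_prop) (by fun_prop)]
  refine integral_congr_ae (ae_of_all _ fun ω => ?_)
  have hin (x : E) : inner ℝ x t = ‖t‖ * inner ℝ (‖t‖⁻¹ • t) x := by
    rw [real_inner_smul_left, real_inner_comm, mul_inv_cancel_left₀ ht']
  simp only [hin, inner_smul_right, inner_sum]
  congr 3

theorem tendstoInDistribution_inv_sqrt_smul_sum {X : ℕ → Ω → E} (hindep : iIndepFun X P)
    (hident : ∀ i, IdentDistrib (X i) (X 0) P P)
    (hmean : ∀ t : E, ∫ ω, inner ℝ t (X 0 ω) ∂P = 0)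
    (hvar : ∀ t : E, ∫ ω, inner ℝ t (X 0 ω) ^ 2 ∂P = ‖t‖ ^ 2) :
    TendstoInDistribution (fun (n : ℕ) ω => (√(n : ℝ))⁻¹ • ∑ j ∈ Finset.range n, X j ω) atTop
      (id : E → E) (fun _ => P) (stdGaussian E) where
  forall_aemeasurable n :=
    (Finset.aemeasurable_fun_sum _ fun j _ => (hident j).aemeasurable_fst).const_smul _
  tendsto := by
    refine ProbabilityMeasure.tendsto_iff_tendsto_charFun.2 fun t => ?_
    simpa using tendsto_charFun_inv_sqrt_smul_sum hindep hident hmean hvar t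

theorem chiSquare_eq_map_stdGaussian (k : ℕ) :
    chiSquare k = (stdGaussian (EuclideanSpace ℝ (Fin k))).map fun x => ‖x‖ ^ 2 := by
  rw [← map_pi_eq_stdGaussian, Measure.map_map (by fun_prop) (by fun_prop), chiSquare]
  congr 1
  ext z
  simp [EuclideanSpace.norm_sq_eq]

end CentralLimit

/-! ### The score has mean zero -/

section ScoreMean

theorem inner_toLp_toLp {α : Type*} [MeasurableSpace α] {μ : Measure α} {f g : α → ℝ}
    (hf : MemLp f 2 μ) (hg : MemLp g 2 μ) :
    inner ℝ (hf.toLp f) (hg.toLp g) = ∫ y, f y * g y ∂μ := by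
  rw [L2.inner_def]
  refine integral_congr_ae ?_
  filter_upwards [hf.coeFn_toLp, hg.coeFn_toLp] with y h1 h2
  rw [h1, h2]
  simp [mul_comm]

theorem norm_toLp_sq {α : Type*} [MeasurableSpace α] {μ : Measure α} {f : α → ℝ}
    (hf : MemLp f 2 μ) : ‖hf.toLp f‖ ^ 2 = ∫ y, f y ^ 2 ∂μ := by
  rw [← real_inner_self_eq_norm_sq, inner_toLp_toLp]
  simp_rw [sq]

variable {k : ℕ} {Θ : Set (EuclideanSpace ℝ (Fin k))} {f : EuclideanSpace ℝ (Fin k) → ℝ → ℝ}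
  {h : ℝ → ℝ} {θ : EuclideanSpace ℝ (Fin k)}

/-- The curve `t ↦ √q(·; θ + tv)` stays on the unit sphere of `L²`, hence is orthogonal to its
derivative `½⟨v, l̇⟩√q` at `0`. This avoids differentiating `∫ q = 1` under the integral sign. -/
theorem IsRegular.integral_inner_score (hreg : IsRegular Θ f h) (hθ : θ ∈ Θ)
    (v : EuclideanSpace ℝ (Fin k)) : ∫ y, inner ℝ v (score f h y θ) ∂(Q f h θ) = 0 := by
  classical
  rcases eq_or_ne v 0 with rfl | hv
  · simp
  have hh := hreg.noise.isDensity
  have hf := hreg.density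
  -- Square integrability is known only for parameters in `Θ`; the default `0` makes the curve
  -- total, and only its germ at `0` matters.
  set F : ℝ → Lp ℝ 2 (volume : Measure ℝ) := fun t =>
    if ht : MemLp (fun y => √(q f h y (θ + t • v))) 2 volume then ht.toLp else 0 with hF
  set b := (hreg.memLp_half_inner_score hθ v).toLp with hb
  have hline : Tendsto (fun t : ℝ => θ + t • v) (𝓝 0) (𝓝 θ) := by
    have : Continuous fun t : ℝ => θ + t • v := by fun_prop
    simpa using this.tendsto 0
  have hmem : ∀ᶠ t : ℝ in 𝓝 0, θ + t • v ∈ Θ := hline.eventually (hreg.isOpen.mem_nhds hθ)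
  have hF0 : F 0 = (memLp_sqrt_q (hf θ hθ) hh).toLp := by
    simp [hF, memLp_sqrt_q (hf θ hθ) hh]
  have hline' : Tendsto (fun t : ℝ => θ + t • v) (𝓝[≠] 0) (𝓝[≠] θ) := by
    refine tendsto_nhdsWithin_iff.2 ⟨hline.mono_left nhdsWithin_le_nhds, ?_⟩
    filter_upwards [self_mem_nhdsWithin] with t ht
    simpa [hv] using ht
  have hderiv : HasDerivAt F b 0 := by
    rw [hasDerivAt_iff_tendsto_slope, tendsto_iff_norm_sub_tendsto_zero]
    have h1 := ((hreg.tendsto_integral_score_sq hθ).comp hline').const_mul (‖v‖ ^ 2)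
    rw [mul_zero] at h1
    have h2 := h1.sqrt
    rw [Real.sqrt_zero] at h2
    refine h2.congr' ?_
    filter_upwards [nhdsWithin_le_nhds hmem, self_mem_nhdsWithin] with t ht ht0
    have ht0' : t ≠ 0 := ht0
    have hFt : F t = (memLp_sqrt_q (hf _ ht) hh).toLp := by
      simp only [hF]
      rw [dif_pos]
    have h3 : slope F 0 t - b = ((((memLp_sqrt_q (hf _ ht) hh).sub
        (memLp_sqrt_q (hf θ hθ) hh)).const_smul t⁻¹).sub
        (hreg.memLp_half_inner_score hθ v)).toLp := by
      rw [slope_def_module, hFt, hF0, sub_zero]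
      rfl
    rw [h3, ← Real.sqrt_sq (norm_nonneg (MemLp.toLp _ _)), norm_toLp_sq]
    congr 1
    simp only [Function.comp_apply]
    rw [← integral_const_mul]
    congr 1 with y
    simp only [add_sub_cancel_left, norm_smul, real_inner_smul_left, Pi.sub_apply, Pi.smul_apply,
      smul_eq_mul, mul_pow, inv_pow, mul_inv, Real.norm_eq_abs, sq_abs]
    have : ‖v‖ ≠ 0 := norm_ne_zero_iff.2 hv
    field_simp
  have hone : (fun t => ‖F t‖ ^ 2) =ᶠ[𝓝 0] fun _ => 1 := by
    filter_upwards [hmem] with t ht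
    have hd := isDensity_q (hf _ ht) hh
    have hFt : F t = (memLp_sqrt_q (hf _ ht) hh).toLp := by
      simp only [hF]
      rw [dif_pos]
    rw [hFt, norm_toLp_sq]
    simp_rw [Real.sq_sqrt (hd.nonneg _)]
    exact hd.integral_eq_one
  have h4 := (hderiv.norm_sq.congr_of_eventuallyEq hone.symm).unique (hasDerivAt_const 0 (1 : ℝ))
  rw [hF0, hb, inner_toLp_toLp] at h4
  have h5 : ∀ y, √(q f h y θ) * (1 / 2 * inner ℝ v (score f h y θ) * √(q f h y θ)) =
      1 / 2 * (q f h y θ * inner ℝ v (score f h y θ)) := fun y => by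
    have := Real.mul_self_sqrt (q_nonneg (hf θ hθ) hh y)
    linear_combination (1 / 2 * inner ℝ v (score f h y θ)) * this
  simp_rw [h5] at h4
  rw [integral_const_mul] at h4
  rw [Q, integral_densityMeasure (measurable_q (hf θ hθ) hh) (q_nonneg (hf θ hθ) hh)]
  linarith

end ScoreMean

/-! ### Whitening and the limit law of the test statistic -/

section ScoreTest

open Matrix

variable {k : ℕ} {Θ : Set (EuclideanSpace ℝ (Fin k))} {f : EuclideanSpace ℝ (Fin k) → ℝ → ℝ}
  {h : ℝ → ℝ} {θ : EuclideanSpace ℝ (Fin k)}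

theorem sum_mul_mul_eq_dotProduct (A : Matrix (Fin k) (Fin k) ℝ) (v : Fin k → ℝ) :
    ∑ i, ∑ j, v i * A i j * v j = v ⬝ᵥ (A *ᵥ v) := by
  simp [dotProduct, mulVec, Finset.mul_sum, mul_assoc]

theorem IsRegular.posDef_fisherInformation (hreg : IsRegular Θ f h) (hθ : θ ∈ Θ) :
    (fisherInformation f h θ).PosDef := by
  refine (PosSemidef.posDef_iff_isUnit ?_).2 (hreg.nonsingular θ hθ)
  refine PosSemidef.of_dotProduct_mulVec_nonneg ?_ fun v => ?_
  · ext i j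
    simp [fisherInformation, mul_comm]
  · have h1 := integral_inner_score_sq (hreg.memLp_score θ hθ) (WithLp.toLp 2 v)
    have h2 : 0 ≤ ∫ y, inner ℝ (WithLp.toLp 2 v) (score f h y θ) ^ 2 ∂(Q f h θ) :=
      integral_nonneg fun y => sq_nonneg _
    rw [h1] at h2
    rw [star_trivial, ← sum_mul_mul_eq_dotProduct]
    simpa only [mul_right_comm] using h2

open scoped MatrixOrder Matrix.Norms.L2Operator in
-- The positive matrix `I⁻¹` factors as `BᵀB`. Then `BᵀBI = 1`, and since a one-sided inverse of a
-- square matrix is two-sided, `BIBᵀ = 1`: `B` turns the score into a vector with identity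
-- covariance.
theorem IsRegular.exists_whitening (hreg : IsRegular Θ f h) (hθ : θ ∈ Θ) :
    ∃ B : Matrix (Fin k) (Fin k) ℝ, Bᵀ * B = (fisherInformation f h θ)⁻¹ ∧
      B * fisherInformation f h θ * Bᵀ = 1 := by
  have hI := hreg.posDef_fisherInformation hθ
  obtain ⟨B, hB⟩ := CStarAlgebra.nonneg_iff_eq_star_mul_self.1 hI.inv.posSemidef.nonneg
  rw [star_eq_conjTranspose, conjTranspose_eq_transpose_of_trivial] at hB
  refine ⟨B, hB.symm, ?_⟩
  have h1 : Bᵀ * (B * fisherInformation f h θ) = 1 := by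
    rw [← Matrix.mul_assoc, ← hB, nonsing_inv_mul _ ((isUnit_iff_isUnit_det _).1 hI.isUnit)]
  exact mul_eq_one_comm.1 h1

theorem inner_toEuclideanCLM_right (B : Matrix (Fin k) (Fin k) ℝ)
    (t x : EuclideanSpace ℝ (Fin k)) :
    inner ℝ t (toEuclideanCLM (𝕜 := ℝ) B x) = inner ℝ (toEuclideanCLM (𝕜 := ℝ) Bᵀ t) x := by
  rw [← conjTranspose_eq_transpose_of_trivial, ← star_eq_conjTranspose, map_star,
    ContinuousLinearMap.star_eq_adjoint, ContinuousLinearMap.adjoint_inner_left]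

theorem norm_toEuclideanCLM_sq (B : Matrix (Fin k) (Fin k) ℝ) (x : EuclideanSpace ℝ (Fin k)) :
    ‖toEuclideanCLM (𝕜 := ℝ) B x‖ ^ 2 = x.ofLp ⬝ᵥ ((Bᵀ * B) *ᵥ x.ofLp) := by
  rw [← mulVec_mulVec, dotProduct_mulVec, vecMul_transpose, EuclideanSpace.real_norm_sq_eq]
  simp [dotProduct, ofLp_toEuclideanCLM, sq]

theorem U_eq_norm_sq {B : Matrix (Fin k) (Fin k) ℝ}
    (hB : Bᵀ * B = (fisherInformation f h 0)⁻¹) (n : ℕ) (Y : ℕ → ℝ) :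
    U f h n Y = ‖(√(n : ℝ))⁻¹ •
      ∑ j ∈ Finset.range n, toEuclideanCLM (𝕜 := ℝ) B (efficientScore f h (Y j))‖ ^ 2 := by
  have hL : L f h = Bᵀ * B := hB.symm
  rw [U, sum_mul_mul_eq_dotProduct, hL, ← norm_toEuclideanCLM_sq, scoreSum, map_smul, map_sum,
    one_div]

theorem IsRegular.integral_inner_whitened_sq (hreg : IsRegular Θ f h) (hθ : θ ∈ Θ)
    {B : Matrix (Fin k) (Fin k) ℝ} (hB : B * fisherInformation f h θ * Bᵀ = 1)
    (t : EuclideanSpace ℝ (Fin k)) :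
    ∫ y, inner ℝ t (toEuclideanCLM (𝕜 := ℝ) B (score f h y θ)) ^ 2 ∂(Q f h θ) = ‖t‖ ^ 2 := by
  simp_rw [inner_toEuclideanCLM_right]
  rw [integral_inner_score_sq (hreg.memLp_score θ hθ)]
  simp_rw [mul_right_comm]
  rw [sum_mul_mul_eq_dotProduct, ofLp_toEuclideanCLM, mulVec_transpose, ← dotProduct_mulVec,
    ← mulVec_transpose, mulVec_mulVec, mulVec_mulVec, hB, one_mulVec,
    EuclideanSpace.real_norm_sq_eq]
  simp [dotProduct, sq]

theorem IsRegular.tendstoInDistribution_U (hreg : IsRegular Θ f h)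
    (h0 : (0 : EuclideanSpace ℝ (Fin k)) ∈ Θ) {Ω : Type*} [MeasurableSpace Ω] (P : Measure Ω)
    [IsProbabilityMeasure P] (X ε : ℕ → Ω → ℝ) (hs : IsSample P (f 0) h X ε) :
    TendstoInDistribution (fun (n : ℕ) (ω : Ω) => U f h n (fun j => X j ω + ε j ω))
      atTop (id : ℝ → ℝ) (fun _ => P) (chiSquare k) := by
  have hf := hreg.density 0 h0
  have hh := hreg.noise.isDensity
  have hsc := hreg.memLp_score 0 h0
  obtain ⟨B, hB, hB'⟩ := hreg.exists_whitening h0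
  set W : ℝ → EuclideanSpace ℝ (Fin k) := fun y =>
    toEuclideanCLM (𝕜 := ℝ) B (efficientScore f h y) with hW
  have hWm : AEMeasurable W (Q f h 0) :=
    ((toEuclideanCLM (𝕜 := ℝ) B).continuous.comp_aestronglyMeasurable hsc.1).aemeasurable
  have hlaw := hs.hasLaw_add hf hh
  have hWm' (j : ℕ) : AEMeasurable W (P.map fun ω => X j ω + ε j ω) := by
    rwa [(hlaw j).map_eq]
  have hindep : iIndepFun (fun j ω => W (X j ω + ε j ω)) P :=
    hs.iIndepFun_add.comp₀ (fun _ => W) (fun j => (hlaw j).aemeasurable) hWm'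
  have hident (j : ℕ) : IdentDistrib (fun ω => W (X j ω + ε j ω)) (fun ω => W (X 0 ω + ε 0 ω))
      P P :=
    ((hlaw j).identDistrib (hlaw 0)).comp_of_aemeasurable (hWm' j)
  have hint (g : EuclideanSpace ℝ (Fin k) → ℝ) (hg : Continuous g) :
      ∫ ω, g (W (X 0 ω + ε 0 ω)) ∂P = ∫ y, g (W y) ∂(Q f h 0) :=
    (hlaw 0).integral_comp (f := fun y => g (W y))
      (hg.measurable.comp_aemeasurable hWm).aestronglyMeasurable
  have hclt := tendstoInDistribution_inv_sqrt_smul_sum hindep hident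
    (fun t => by
      rw [hint (fun x => inner ℝ t x) (by fun_prop)]
      simp_rw [hW, inner_toEuclideanCLM_right]
      exact hreg.integral_inner_score h0 _)
    (fun t => by
      rw [hint (fun x => inner ℝ t x ^ 2) (by fun_prop)]
      exact hreg.integral_inner_whitened_sq h0 hB' t)
  have hsq := hclt.continuous_comp (g := fun x => ‖x‖ ^ 2) (by fun_prop)
  have hU : (fun (n : ℕ) (ω : Ω) => U f h n (fun j => X j ω + ε j ω)) = fun (n : ℕ) =>
      (fun x : EuclideanSpace ℝ (Fin k) => ‖x‖ ^ 2) ∘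
        fun ω => (√(n : ℝ))⁻¹ • ∑ j ∈ Finset.range n, W (X j ω + ε j ω) := by
    ext n ω
    exact U_eq_norm_sq hB n _
  rw [hU]
  refine ⟨hsq.forall_aemeasurable, aemeasurable_id, ?_⟩
  -- The limit appears as `‖x‖²` for `x` standard Gaussian; its law is `chiSquare k`, the law of
  -- `id` in the goal.
  convert! hsq.tendsto using 2
  simp [chiSquare_eq_map_stdGaussian]

end ScoreTest

end Deconvolution

theorem mainTheorem3 {k : ℕ} (Θ : Set (EuclideanSpace ℝ (Fin k)))
    (f : EuclideanSpace ℝ (Fin k) → ℝ → ℝ) (h : ℝ → ℝ)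
    (hreg : Deconvolution.IsRegular Θ f h) (h0 : (0 : EuclideanSpace ℝ (Fin k)) ∈ Θ) :
    ((∀ᵐ y : ℝ, DifferentiableAt ℝ
        (fun θ : EuclideanSpace ℝ (Fin k) => ∫ s, f θ s * h (y - s)) 0) ∧
      (∀ y : ℝ, Deconvolution.efficientScore f h y =
        (∫ s, f 0 s * h (y - s))⁻¹ •
          gradient (fun θ : EuclideanSpace ℝ (Fin k) => ∫ s, f θ s * h (y - s)) 0) ∧
      Deconvolution.IsQuadraticMeanScore f h 0 (Deconvolution.efficientScore f h)) ∧
    ∀ {Ω : Type*} [MeasurableSpace Ω] (P : Measure Ω) [IsProbabilityMeasure P]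
      (X ε : ℕ → Ω → ℝ), Deconvolution.IsSample P (f 0) h X ε →
      TendstoInDistribution
        (fun (n : ℕ) (ω : Ω) => Deconvolution.U f h n (fun j => X j ω + ε j ω))
        atTop (id : ℝ → ℝ) (fun _ => P) (Deconvolution.chiSquare k) := by
  refine ⟨⟨?_, fun y => ?_, hreg.isQuadraticMeanScore h0⟩, hreg.tendstoInDistribution_U h0⟩
  · filter_upwards [hreg.contDiff] with y hy
    exact (hy.differentiableOn one_ne_zero _ h0).differentiableAt (hreg.isOpen.mem_nhds h0)
  · exact Deconvolution.score_eq_inv_smul (hreg.density 0 h0) hreg.noise.isDensity y
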